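/- Graphs are undirected and may have multiple edges and loops. Formally, a graph consists of a vertex set $V$, a set $\overline{E}$ of directed edges, maps $h,t:\overline{E}\to V$ (head and tail) and an involution $e\mapsto e^{-1}$ of $\overline{E}$ with $h(e^{-1})=t(e)$; a loop $e$ (that is, $h(e)=t(e)$) is a half-loop if $e^{-1}=e$ and a whole-loop otherwise. A walk is a sequence of directed edges $e_1,\dots,e_k$ with $h(e_i)=t(e_{i+1})$; it is non-backtracking if $e_{i+1}\neq e_i^{-1}$ for all $i$. A cycle is a closed non-backtracking walk of positive length that repeats no vertex (so a loop of either kind is a cycle of length one), and the girth of a graph is the length of its shortest cycle ($\infty$ if there is none). A graph $G$ is a lift of $H$ if there is a surjective graph homomorphism $\pi:G\to H$ that, for every vertex $v$ of $G$, maps the edges emanating from $v$ bijectively onto the edges emanating from $\pi(v)$. The universal cover $\tilde H$ of a connected graph $H$ is the tree whose vertices are the finite non-backtracking walks of $H$ from a fixed vertex, two walks being adjacent if one extends the other by a single step; up to isomorphism it does not depend on the fixed vertex. For a finite connected (nonempty) graph $H$, let ${\cal L}(H)$ be the family of finite connected graphs that are lifts of $H$, and let ${\cal U}(H)$ be the family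 of finite connected graphs $G$ with $\tilde G\cong\tilde H$. For a family ${\cal G}$ of graphs and an integer $g\ge 0$, let $n({\cal G},g)$ be the smallest number of vertices of a graph of girth at least $g$ in ${\cal G}$. **Lemma.** For every finite connected graph $H$ there is a constant $c(H)$, depending only on $H$, such that for every integer $g\ge 0$ the numbers $n({\cal L}(H),g)$ and $n({\cal U}(H),g)$ are well defined (the minima are over nonempty sets) and $$c(H)\cdot n({\cal U}(H),g)\;\ge\; n({\cal L}(H),g)\;\ge\; n({\cal U}(H),g).$$ -/

import Mathlib

universe u

/-- An undirected graph with multiple edges and loops: `V` is the vertex set, `E` the set of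
*directed* edges, and `inv` the involution that sends a directed edge to its inverse.
A loop (`head e = tail e`) is a half-loop if `inv e = e`, and a whole-loop otherwise. -/
structure LoopGraph where
  V : Type u
  E : Type u
  head : E → V
  tail : E → V
  inv : E → E
  inv_inv : ∀ e, inv (inv e) = e
  head_inv : ∀ e, head (inv e) = tail e

namespace LoopGraph

theorem tail_inv (G : LoopGraph.{u}) (e : G.E) : G.tail (G.inv e) = G.head e := by
  rw [← G.head_inv, G.inv_inv]

/-- A finite graph: finitely many vertices and finitely many edges. -/
def IsFinite (G : LoopGraph.{u}) : Prop := Finite G.V ∧ Finite G.E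

/-- `G.IsWalk u l v`: the sequence `l` of directed edges is a walk from `u` to `v`. -/
def IsWalk (G : LoopGraph.{u}) : G.V → List G.E → G.V → Prop
  | u, [], v => u = v
  | u, e :: l, v => G.tail e = u ∧ IsWalk G (G.head e) l v

/-- No edge of the sequence is immediately followed by its inverse. -/
def NonBacktracking (G : LoopGraph.{u}) (l : List G.E) : Prop :=
  l.IsChain (fun e f => f ≠ G.inv e)

/-- A connected graph is nonempty, and any two of its vertices are joined by a walk. -/
def Connected (G : LoopGraph.{u}) : Prop :=
  Nonempty G.V ∧ ∀ u v : G.V, ∃ l, G.IsWalk u l v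

/-- A cycle: a closed non-backtracking walk of positive length that repeats no vertex. The cycles
of length one are the loops of both kinds, those of length two are the pairs of parallel edges. -/
def IsCycle (G : LoopGraph.{u}) (l : List G.E) : Prop :=
  l ≠ [] ∧ (∃ v, G.IsWalk v l v) ∧ G.NonBacktracking l ∧ (l.map G.tail).Nodup

/-- The girth: the length of a shortest cycle, `⊤` if there is no cycle. -/
noncomputable def girth (G : LoopGraph.{u}) : ℕ∞ :=
  ⨅ (l : List G.E) (_ : G.IsCycle l), (l.length : ℕ∞)

/-- A graph homomorphism. -/
structure Hom (G H : LoopGraph.{u}) where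
  onV : G.V → H.V
  onE : G.E → H.E
  head_onE : ∀ e, H.head (onE e) = onV (G.head e)
  tail_onE : ∀ e, H.tail (onE e) = onV (G.tail e)
  inv_onE : ∀ e, H.inv (onE e) = onE (G.inv e)

/-- A covering map: a surjective homomorphism that maps the edges emanating from `v` bijectively
onto the edges emanating from the image of `v`, for every vertex `v`. -/
def Hom.IsCovering {G H : LoopGraph.{u}} (π : Hom G H) : Prop :=
  Function.Surjective π.onV ∧ Function.Surjective π.onE ∧
    ∀ v : G.V, Set.BijOn π.onE {e | G.tail e = v} {f | H.tail f = π.onV v}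

/-- `G` covers `H`, that is, `G` is a lift of `H`. -/
def IsLift (G H : LoopGraph.{u}) : Prop := ∃ π : Hom G H, π.IsCovering

/-- Two graphs are isomorphic. -/
def Isomorphic (G H : LoopGraph.{u}) : Prop :=
  ∃ π : Hom G H, Function.Bijective π.onV ∧ Function.Bijective π.onE

/-- The non-backtracking walks that start at `r`. -/
def NBWalk (G : LoopGraph.{u}) (r : G.V) : Type u :=
  {l : List G.E // (∃ v, G.IsWalk r l v) ∧ G.NonBacktracking l}

/-- The walk `w'` extends the walk `w` by a single step. -/
def NBWalk.Extends {G : LoopGraph.{u}} {r : G.V} (w w' : G.NBWalk r) : Prop :=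
  ∃ e : G.E, w'.1 = w.1 ++ [e]

/-- The universal cover of a connected graph `G`, constructed from a vertex `r`: the tree whose
vertices are the finite non-backtracking walks from `r`, two of them being adjacent (by one
directed edge in each direction) if one extends the other by a single step. -/
def universalCover (G : LoopGraph.{u}) (r : G.V) : LoopGraph.{u} where
  V := G.NBWalk r
  E := {p : G.NBWalk r × G.NBWalk r // p.1.Extends p.2 ∨ p.2.Extends p.1}
  head p := p.1.2
  tail p := p.1.1
  inv p := ⟨(p.1.2, p.1.1), p.2.symm⟩
  inv_inv _ := rfl
  head_inv _ := rfl

/-- `G` and `H` have the same universal cover, up to isomorphism. For connected graphs the choice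
of the starting vertices is immaterial, as it does not change the isomorphism classes. -/
def SameUniversalCover (G H : LoopGraph.{u}) : Prop :=
  ∃ (r : G.V) (s : H.V), Isomorphic (G.universalCover r) (H.universalCover s)

/-- The family `𝓛(H)` of the finite connected graphs that are lifts of `H`. -/
def lifts (H : LoopGraph.{u}) : Set LoopGraph.{u} :=
  {G | G.IsFinite ∧ G.Connected ∧ G.IsLift H}

/-- The family `𝓤(H)` of the finite connected graphs with the same universal cover as `H`. -/
def sharingUniversalCover (H : LoopGraph.{u}) : Set LoopGraph.{u} :=
  {G | G.IsFinite ∧ G.Connected ∧ G.SameUniversalCover H}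

/-- `n(𝓖, g)`: the smallest number of vertices of a graph of girth at least `g` in the
family `𝓖`; it is `⊤` if there is no such graph. -/
noncomputable def minSize (𝓖 : Set LoopGraph.{u}) (g : ℕ) : ℕ∞ :=
  ⨅ (G : LoopGraph.{u}) (_ : G ∈ 𝓖 ∧ (g : ℕ∞) ≤ G.girth), ENat.card G.V

end LoopGraph

/-!
The covering maps of the statement are handled through *local isomorphisms*, homomorphisms that
are bijective on the edges emanating from each vertex. Such a map sends non-backtracking walks to
non-backtracking walks, and a closed non-backtracking walk contains a cycle, so the girth of its
source is at least that of its target (`Hom.IsLocalIso.girth_le`). If the source is finite and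
nonempty and the target connected, each component of the source is a lift of the target. Hence an
element of `𝓛(H)` of girth at least `g` is obtained from any finite nonempty graph of girth at
least `g` with a local isomorphism to `H` (`minSize_lifts_le`).

* Such graphs exist: `voltageLift` is a voltage graph over the bipartite double cover of `H`, with
  voltages in a group of permutations of reduced words in which the generating involutions satisfy
  no short reduced relation (`ReducedWord.prod_togglePerm_apply_nil`).
* Walks lift uniquely, so a lift of `H` has the same universal cover as `H`; this gives
  `𝓛(H) ⊆ 𝓤(H)` and the inequality between the minima that needs no constant.
* The other inequality is Leighton's theorem with a bound for the size. If `G` and `H` have the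
  same universal cover `T`, then `T` has local isomorphisms to both. Identifying the two images of
  each vertex of `T` yields colourings of `G` and `H` that are equitable with the same degree
  matrix (`exists_equitable`). Leighton's common cover consists of `a i` copies of each pair of
  vertices of colour `i` and `b i j` copies of each pair of edges from colour `i` to colour `j`.
  It can be glued together if `b i j * r i j = a i` and `b i j = b j i`, where `r` is the degree
  matrix. With `s = |V(H)|! * |E(H)|!` this is achieved by dividing `s` by the number of vertices
  of `H` of colour `i`, respectively of edges of `H` from colour `i` to colour `j`. So the common
  cover has at most `|V(H)| * s * |V(G)|` vertices, and its girth is at least that of `G`.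
-/

namespace LoopGraph

variable {G H K : LoopGraph.{u}}

/-! ### Walks -/

theorem isWalk_append {u w : G.V} {l₁ l₂ : List G.E} :
    G.IsWalk u (l₁ ++ l₂) w ↔ ∃ v, G.IsWalk u l₁ v ∧ G.IsWalk v l₂ w := by
  induction l₁ generalizing u with
  | nil => simp [IsWalk]
  | cons e l ih => simp [IsWalk, ih, and_assoc]

theorem IsWalk.unique {u v w : G.V} {l : List G.E} (h : G.IsWalk u l v) (h' : G.IsWalk u l w) :
    v = w := by
  induction l generalizing u with
  | nil => exact Eq.trans (Eq.symm h) h'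
  | cons e l ih => exact ih h.2 h'.2

theorem IsWalk.reverse {u v : G.V} {l : List G.E} (h : G.IsWalk u l v) :
    ∃ l', G.IsWalk v l' u := by
  induction l generalizing u with
  | nil => exact ⟨[], Eq.symm h⟩
  | cons e l ih =>
    obtain ⟨l', hl'⟩ := ih h.2
    refine ⟨l' ++ [G.inv e], isWalk_append.2 ⟨_, hl', ?_⟩⟩
    exact ⟨G.tail_inv e, (G.head_inv e).trans h.1⟩

theorem IsWalk.map (π : Hom G H) {u v : G.V} {l : List G.E} (h : G.IsWalk u l v) :
    H.IsWalk (π.onV u) (l.map π.onE) (π.onV v) := by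
  induction l generalizing u with
  | nil => exact congrArg π.onV h
  | cons e l ih =>
    refine ⟨by rw [π.tail_onE, h.1], ?_⟩
    rw [π.head_onE]
    exact ih h.2

/-- In a non-backtracking walk, each edge starts where the preceding one ends and is not its
inverse. -/
theorem IsWalk.isChain {u v : G.V} {l : List G.E} (h : G.IsWalk u l v)
    (hnb : G.NonBacktracking l) :
    l.IsChain (fun e f => f ≠ G.inv e ∧ G.tail f = G.head e) := by
  induction l generalizing u with
  | nil => exact .nil
  | cons e l ih =>
    cases l with
    | nil => exact .singleton _
    | cons f l => exact .cons_cons ⟨hnb.rel, h.2.1⟩ (ih h.2 hnb.tail)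

/-! ### Girth -/

/-- A walk that repeats a vertex properly contains a closed walk of positive length. -/
theorem IsWalk.exists_shorter_closed {u v : G.V} {l : List G.E} (h : G.IsWalk u l v)
    (hnb : G.NonBacktracking l) (hd : ¬ (l.map G.tail).Nodup) :
    ∃ l' w, G.IsWalk w l' w ∧ G.NonBacktracking l' ∧ l' ≠ [] ∧ l'.length < l.length := by
  induction l generalizing u with
  | nil => simp at hd
  | cons e l ih =>
    by_cases hl : (l.map G.tail).Nodup
    · have hmem : G.tail e ∈ l.map G.tail := by
        by_contra hne
        exact hd (by simpa using ⟨by simpa using hne, hl⟩)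
      obtain ⟨f, hf, hfe⟩ := List.mem_map.1 hmem
      obtain ⟨s, t, rfl⟩ := List.append_of_mem hf
      rw [← List.cons_append] at h hnb
      obtain ⟨w, hw, hw'⟩ := isWalk_append.1 h
      have hwu : w = u := by rw [← hw'.1, hfe, hw.1]
      subst hwu
      exact ⟨e :: s, w, hw, hnb.left_of_append, by simp, by simp⟩
    · obtain ⟨l', w, h1, h2, h3, h4⟩ := ih h.2 hnb.tail hl
      exact ⟨l', w, h1, h2, h3, h4.trans (by simp)⟩

theorem girth_le_of_closed {v : G.V} {l : List G.E} (h : G.IsWalk v l v)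
    (hnb : G.NonBacktracking l) (hl : l ≠ []) : G.girth ≤ l.length := by
  induction hn : l.length using Nat.strong_induction_on generalizing l v with
  | _ n ih =>
    by_cases hd : (l.map G.tail).Nodup
    · rw [← hn]
      exact iInf₂_le l ⟨hl, ⟨v, h⟩, hnb, hd⟩
    · obtain ⟨l', w, h1, h2, h3, h4⟩ := h.exists_shorter_closed hnb hd
      refine (ih _ (hn ▸ h4) h1 h2 h3 rfl).trans ?_
      exact_mod_cast (hn ▸ h4).le

/-! ### Locally bijective homomorphisms -/

/-- A homomorphism is a local isomorphism if it maps the edges emanating from each vertex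
bijectively onto the edges emanating from its image. Covering maps are the surjective ones. -/
def Hom.IsLocalIso (π : Hom G H) : Prop :=
  ∀ v : G.V, Set.BijOn π.onE {e | G.tail e = v} {f | H.tail f = π.onV v}

/-- The composition of homomorphisms. -/
def Hom.comp (ρ : Hom G H) (π : Hom K G) : Hom K H where
  onV := ρ.onV ∘ π.onV
  onE := ρ.onE ∘ π.onE
  head_onE e := by simp [ρ.head_onE, π.head_onE]
  tail_onE e := by simp [ρ.tail_onE, π.tail_onE]
  inv_onE e := by simp [ρ.inv_onE, π.inv_onE]

theorem Hom.IsLocalIso.comp {ρ : Hom G H} {π : Hom K G} (hρ : ρ.IsLocalIso)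
    (hπ : π.IsLocalIso) : (ρ.comp π).IsLocalIso :=
  fun v => (hρ (π.onV v)).comp (hπ v)

theorem Hom.isLocalIso_of_bijective (π : Hom G H) (hV : Function.Bijective π.onV)
    (hE : Function.Bijective π.onE) : π.IsLocalIso := by
  intro v
  refine ⟨fun e he => ?_, hE.1.injOn, fun f hf => ?_⟩
  · exact (π.tail_onE e).trans (congrArg _ he)
  · obtain ⟨e, rfl⟩ := hE.2 f
    exact ⟨e, hV.1 ((π.tail_onE e).symm.trans hf), rfl⟩

theorem Hom.IsLocalIso.nonBacktracking_map {π : Hom G H} (hπ : π.IsLocalIso) {u v : G.V}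
    {l : List G.E} (hw : G.IsWalk u l v) (h : G.NonBacktracking l) :
    H.NonBacktracking (l.map π.onE) := by
  rw [NonBacktracking, List.isChain_map]
  refine (hw.isChain h).imp fun e f hef heq => hef.1 ?_
  rw [π.inv_onE] at heq
  exact (hπ (G.head e)).injOn hef.2 (G.tail_inv e) heq

theorem Hom.nonBacktracking_of_map (π : Hom G H) {l : List G.E}
    (h : H.NonBacktracking (l.map π.onE)) : G.NonBacktracking l := by
  rw [NonBacktracking, List.isChain_map] at h
  refine h.imp fun e f hef heq => hef ?_
  rw [heq, π.inv_onE]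

theorem Hom.IsLocalIso.girth_le {π : Hom G H} (hπ : π.IsLocalIso) : H.girth ≤ G.girth := by
  refine le_iInf₂ fun l hl => ?_
  obtain ⟨hne, ⟨v, hv⟩, hnb, -⟩ := hl
  simpa using girth_le_of_closed (hv.map π) (hπ.nonBacktracking_map hv hnb) (by simpa using hne)

/-- Walks lift along a local isomorphism. -/
theorem Hom.IsLocalIso.exists_lift {π : Hom G H} (hπ : π.IsLocalIso) {u : G.V} {w : H.V}
    {l : List H.E} (h : H.IsWalk (π.onV u) l w) :
    ∃ l' v, G.IsWalk u l' v ∧ l'.map π.onE = l ∧ π.onV v = w := by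
  induction l generalizing u with
  | nil => exact ⟨[], u, rfl, rfl, h⟩
  | cons f l ih =>
    obtain ⟨e, he, rfl⟩ := (hπ u).surjOn h.1
    have h2 := h.2
    rw [π.head_onE] at h2
    obtain ⟨l', v, h1, rfl, h3⟩ := ih h2
    exact ⟨e :: l', v, ⟨he, h1⟩, rfl, h3⟩

/-- Lifts of walks are unique. -/
theorem Hom.IsLocalIso.lift_unique {π : Hom G H} (hπ : π.IsLocalIso) {u v v' : G.V}
    {l l' : List G.E} (h : G.IsWalk u l v) (h' : G.IsWalk u l' v')
    (heq : l.map π.onE = l'.map π.onE) : l = l' := by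
  induction l generalizing u l' with
  | nil => simpa using heq.symm
  | cons e l ih =>
    cases l' with
    | nil => simp at heq
    | cons e' l' =>
      simp only [List.map_cons, List.cons.injEq] at heq
      obtain rfl := (hπ u).injOn h.1 h'.1 heq.1
      rw [ih h.2 h'.2 heq.2]

theorem Hom.IsLocalIso.isCovering {π : Hom G H} (hπ : π.IsLocalIso) (hG : Nonempty G.V)
    (hH : H.Connected) : π.IsCovering := by
  have hV : Function.Surjective π.onV := fun w => by
    obtain ⟨u⟩ := hG
    obtain ⟨l, hl⟩ := hH.2 (π.onV u) w
    obtain ⟨-, v, -, -, hv⟩ := hπ.exists_lift hl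
    exact ⟨v, hv⟩
  refine ⟨hV, fun f => ?_, hπ⟩
  obtain ⟨v, hv⟩ := hV (H.tail f)
  obtain ⟨e, -, he⟩ := (hπ v).surjOn hv.symm
  exact ⟨e, he⟩

/-! ### Connected components -/

/-- The connected component of the vertex `r`. -/
def component (G : LoopGraph.{u}) (r : G.V) : LoopGraph.{u} where
  V := {v : G.V // ∃ l, G.IsWalk r l v}
  E := {e : G.E // ∃ l, G.IsWalk r l (G.tail e)}
  head e := ⟨G.head e.1, by
    obtain ⟨l, hl⟩ := e.2
    exact ⟨l ++ [e.1], isWalk_append.2 ⟨_, hl, rfl, rfl⟩⟩⟩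
  tail e := ⟨G.tail e.1, e.2⟩
  inv e := ⟨G.inv e.1, by
    obtain ⟨l, hl⟩ := e.2
    exact ⟨l ++ [e.1], isWalk_append.2 ⟨_, hl, rfl, (G.tail_inv _).symm⟩⟩⟩
  inv_inv e := Subtype.ext (G.inv_inv _)
  head_inv e := Subtype.ext (G.head_inv _)

/-- The inclusion of a connected component. -/
def componentHom (G : LoopGraph.{u}) (r : G.V) : Hom (G.component r) G where
  onV := Subtype.val
  onE := Subtype.val
  head_onE _ := rfl
  tail_onE _ := rfl
  inv_onE _ := rfl

theorem componentHom_isLocalIso (r : G.V) : (G.componentHom r).IsLocalIso := by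
  intro v
  refine ⟨?_, Subtype.val_injective.injOn, ?_⟩
  · rintro e rfl
    exact rfl
  · intro f hf
    exact ⟨⟨f, by rw [show G.tail f = v.1 from hf]; exact v.2⟩, Subtype.ext hf, rfl⟩

theorem component_connected (r : G.V) : (G.component r).Connected := by
  let r' : (G.component r).V := ⟨r, [], rfl⟩
  have key : ∀ v, ∃ l, (G.component r).IsWalk r' l v := by
    rintro ⟨v, l, hl⟩
    obtain ⟨l', v', h1, -, h2⟩ := (componentHom_isLocalIso r).exists_lift (u := r') hl
    exact ⟨l', (Subtype.ext h2 : v' = ⟨v, l, hl⟩) ▸ h1⟩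
  refine ⟨⟨r'⟩, fun u v => ?_⟩
  obtain ⟨l, hl⟩ := key u
  obtain ⟨l₁, h₁⟩ := hl.reverse
  obtain ⟨l₂, h₂⟩ := key v
  exact ⟨l₁ ++ l₂, isWalk_append.2 ⟨_, h₁, h₂⟩⟩

/-- A finite nonempty graph with a local isomorphism to a connected graph `H` yields, by passing
to a component, an element of `𝓛(H)`. -/
theorem minSize_lifts_le (hH : H.Connected) (hK : K.IsFinite) (r : K.V) {π : Hom K H}
    (hπ : π.IsLocalIso) {g : ℕ} (hg : (g : ℕ∞) ≤ K.girth) :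
    minSize H.lifts g ≤ Nat.card K.V := by
  have := hK.1
  have := hK.2
  have hι := componentHom_isLocalIso r
  have hfin : (K.component r).IsFinite :=
    ⟨inferInstanceAs (Finite {v : K.V // _}), inferInstanceAs (Finite {v : K.E // _})⟩
  have hcov := (hπ.comp hι).isCovering (component_connected r).1 hH
  refine (iInf₂_le (K.component r)
    ⟨⟨hfin, component_connected r, _, hcov⟩, hg.trans hι.girth_le⟩).trans ?_
  rw [← ENat.card_eq_coe_natCard K.V]
  exact ENat.card_le_card_of_injective Subtype.val_injective

/-! ### Lifts of large girth -/

/-- The words of length at most `n` over the alphabet `A` without two equal consecutive letters. -/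
abbrev ReducedWord (A : Type u) (n : ℕ) : Type u :=
  {l : List A // l.length ≤ n ∧ l.IsChain (· ≠ ·)}

instance ReducedWord.instFinite (A : Type u) [Finite A] (n : ℕ) : Finite (ReducedWord A n) :=
  ((List.finite_length_le A n).subset fun _ h => h.1).to_subtype

open Classical in
/-- Cancels the letter `a` at the front of a reduced word or, if this is not possible, puts it
there; words of maximal length that do not start with `a` are left unchanged. -/
noncomputable def ReducedWord.toggle {A : Type u} {n : ℕ} (a : A) (w : ReducedWord A n) :
    ReducedWord A n :=
  if h : w.1.head? = some a then
    ⟨w.1.tail, by simpa using w.2.1.trans (Nat.le_succ n), w.2.2.tail⟩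
  else if hn : w.1.length < n then
    ⟨a :: w.1, hn, List.isChain_cons.2 ⟨fun b hb hab => h (by rw [hab]; exact hb), w.2.2⟩⟩
  else w

theorem ReducedWord.toggle_cons {A : Type u} {n : ℕ} (a : A) (l : List A)
    (h : (a :: l).length ≤ n ∧ (a :: l).IsChain (· ≠ ·)) :
    toggle (n := n) a ⟨a :: l, h⟩ = ⟨l, (Nat.le_succ _).trans h.1, h.2.tail⟩ := by
  simp [toggle]

theorem ReducedWord.toggle_of_cons {A : Type u} {n : ℕ} (a : A) (l : List A)
    (h : (a :: l).length ≤ n ∧ (a :: l).IsChain (· ≠ ·)) :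
    toggle (n := n) a ⟨l, (Nat.le_succ _).trans h.1, h.2.tail⟩ = ⟨a :: l, h⟩ := by
  have h1 : l.head? ≠ some a := fun hl => (List.isChain_cons.1 h.2).1 a hl rfl
  have h2 : l.length < n := h.1
  simp [toggle, h1, h2]

theorem ReducedWord.toggle_involutive {A : Type u} {n : ℕ} (a : A) :
    Function.Involutive (toggle (n := n) a) := by
  rintro ⟨l, hl⟩
  by_cases h : l.head? = some a
  · obtain ⟨t, rfl⟩ := List.head?_eq_some_iff.1 h
    rw [toggle_cons, toggle_of_cons]
  · by_cases hn : l.length < n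
    · have hc : (a :: l).length ≤ n ∧ (a :: l).IsChain (· ≠ ·) :=
        ⟨hn, List.isChain_cons.2 ⟨fun b hb hab => h (by rw [hab]; exact hb), hl.2⟩⟩
      rw [toggle_of_cons a l hc, toggle_cons]
    · have h1 : toggle (n := n) a ⟨l, hl⟩ = ⟨l, hl⟩ := by simp [toggle, h, hn]
      rw [h1, h1]

/-- `ReducedWord.toggle` as a permutation. -/
noncomputable def ReducedWord.togglePerm {A : Type u} (n : ℕ) (a : A) :
    Equiv.Perm (ReducedWord A n) :=
  (toggle_involutive a).toPerm

theorem ReducedWord.togglePerm_mul_self {A : Type u} (n : ℕ) (a : A) :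
    togglePerm n a * togglePerm n a = 1 :=
  Equiv.ext fun w => toggle_involutive a w

/-- The product of the permutations given by the letters of a reduced word `l` moves the empty
word to `l`; so the group they generate has no short nontrivial reduced relation. -/
theorem ReducedWord.prod_togglePerm_apply_nil {A : Type u} {n : ℕ} (l : List A)
    (h : l.length ≤ n ∧ l.IsChain (· ≠ ·)) :
    (l.map (togglePerm n)).prod ⟨[], Nat.zero_le n, .nil⟩ = ⟨l, h⟩ := by
  induction l with
  | nil => rfl
  | cons a l ih =>
    rw [List.map_cons, List.prod_cons, Equiv.Perm.mul_apply,
      ih ⟨(Nat.le_succ _).trans h.1, h.2.tail⟩]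
    exact toggle_of_cons a l h

/-- The label of the edge over `e` on the sheet `x` of the bipartite double cover of `H`. The
edge and its inverse `(e⁻¹, !x)` have the same label. -/
def doubleLabel (H : LoopGraph.{u}) (e : H.E) (x : Bool) : H.E :=
  if x then e else H.inv e

theorem doubleLabel_inv (e : H.E) (x : Bool) :
    H.doubleLabel (H.inv e) (!x) = H.doubleLabel e x := by
  cases x <;> simp [doubleLabel, H.inv_inv]

theorem eq_inv_of_doubleLabel_eq {e f : H.E} {x : Bool}
    (h : H.doubleLabel e x = H.doubleLabel f (!x)) : f = H.inv e := by
  cases x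
  · simpa [doubleLabel] using h.symm
  · simp only [doubleLabel, Bool.not_true, Bool.false_eq_true, if_true, if_false] at h
    rw [h, H.inv_inv]

/-- The lift of `H` with the vertices `(v, x, σ)`, in which the edge over `e` leads from
`(tail e, x, σ)` to `(head e, !x, σ * τ)`, where `τ` toggles the label of `(e, x)`. The second
coordinate turns the edges into undirected ones with distinct ends, so that the involutions `τ`
suffice as voltages, for half-loops and whole-loops alike. -/
noncomputable def voltageLift (H : LoopGraph.{u}) (n : ℕ) : LoopGraph.{u} where
  V := H.V × Bool × Equiv.Perm (ReducedWord H.E n)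
  E := H.E × Bool × Equiv.Perm (ReducedWord H.E n)
  head y := (H.head y.1, !y.2.1, y.2.2 * ReducedWord.togglePerm n (H.doubleLabel y.1 y.2.1))
  tail y := (H.tail y.1, y.2)
  inv y := (H.inv y.1, !y.2.1, y.2.2 * ReducedWord.togglePerm n (H.doubleLabel y.1 y.2.1))
  inv_inv y := by
    simp [H.inv_inv, doubleLabel_inv, mul_assoc, ReducedWord.togglePerm_mul_self]
  head_inv y := by
    simp [H.head_inv, doubleLabel_inv, mul_assoc, ReducedWord.togglePerm_mul_self]

/-- The label of an edge of the voltage lift. -/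
def voltageLabel (H : LoopGraph.{u}) {n : ℕ} (y : (H.voltageLift n).E) : H.E :=
  H.doubleLabel y.1 y.2.1

/-- The projection of the voltage lift. -/
noncomputable def voltageLiftHom (H : LoopGraph.{u}) (n : ℕ) : Hom (H.voltageLift n) H where
  onV := Prod.fst
  onE := Prod.fst
  head_onE _ := rfl
  tail_onE _ := rfl
  inv_onE _ := rfl

theorem voltageLiftHom_isLocalIso (n : ℕ) : (H.voltageLiftHom n).IsLocalIso := by
  rintro ⟨v, z⟩
  refine ⟨?_, ?_, ?_⟩
  · intro y hy
    exact congrArg Prod.fst hy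
  · rintro ⟨e, z₁⟩ h₁ ⟨e', z₂⟩ h₂ (rfl : e = e')
    exact Prod.ext rfl ((congrArg Prod.snd h₁).trans (congrArg Prod.snd h₂).symm)
  · intro f hf
    exact ⟨(f, z), Prod.ext hf rfl, rfl⟩

theorem voltageLift_isFinite (hH : H.IsFinite) (n : ℕ) : (H.voltageLift n).IsFinite := by
  have := hH.1
  have := hH.2
  exact ⟨inferInstanceAs (Finite (H.V × Bool × Equiv.Perm (ReducedWord H.E n))),
    inferInstanceAs (Finite (H.E × Bool × Equiv.Perm (ReducedWord H.E n)))⟩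

theorem voltageLift_walk_prod {n : ℕ} {u v : (H.voltageLift n).V}
    {l : List (H.voltageLift n).E} (h : (H.voltageLift n).IsWalk u l v) :
    v.2.2 = u.2.2 *
      ((l.map H.voltageLabel).map (ReducedWord.togglePerm n)).prod := by
  induction l generalizing u with
  | nil => simp [show u = v from h]
  | cons y l ih =>
    rw [ih h.2, ← h.1]
    rw [List.map_cons, List.map_cons, List.prod_cons, ← mul_assoc]
    rfl

theorem le_girth_voltageLift (n : ℕ) : (n : ℕ∞) ≤ (H.voltageLift n).girth := by
  refine le_iInf₂ fun l hl => ?_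
  obtain ⟨hne, ⟨v, hv⟩, hnb, -⟩ := hl
  by_contra! hlt
  have hlt : l.length < n := by exact_mod_cast hlt
  have hchain : (l.map H.voltageLabel).IsChain (· ≠ ·) := by
    rw [List.isChain_map]
    refine (hv.isChain hnb).imp ?_
    rintro ⟨e, x, σ⟩ ⟨f, x', σ'⟩ ⟨hef, ht⟩ heq
    obtain ⟨-, rfl, rfl⟩ : H.tail f = H.head e ∧ x' = !x ∧ _ := by
      simpa [voltageLift] using ht
    exact hef (Prod.ext (eq_inv_of_doubleLabel_eq heq) rfl)
  -- The walk is closed, so the product of its voltages is `1` and fixes the empty word.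
  have hprod := voltageLift_walk_prod hv
  rw [left_eq_mul] at hprod
  have := ReducedWord.prod_togglePerm_apply_nil (n := n) _ ⟨by simpa using hlt.le, hchain⟩
  rw [hprod] at this
  exact hne (by simpa using (congrArg Subtype.val this).symm)

theorem minSize_lifts_ne_top (hfin : H.IsFinite) (hconn : H.Connected) (g : ℕ) :
    minSize H.lifts g ≠ ⊤ := by
  obtain ⟨v⟩ := hconn.1
  exact ((minSize_lifts_le hconn (voltageLift_isFinite hfin g) (v, true, 1)
    (voltageLiftHom_isLocalIso g) (le_girth_voltageLift g)).trans_lt (ENat.natCast_lt_top _)).ne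

/-! ### The universal cover -/

/-- The last vertex of a non-backtracking walk. -/
noncomputable def NBWalk.last {r : G.V} (w : G.NBWalk r) : G.V := w.2.1.choose

theorem NBWalk.isWalk {r : G.V} (w : G.NBWalk r) : G.IsWalk r w.1 w.last := w.2.1.choose_spec

theorem NBWalk.last_of_append {r : G.V} {w w' : G.NBWalk r} {e : G.E} (h : w'.1 = w.1 ++ [e]) :
    G.tail e = w.last ∧ w'.last = G.head e := by
  have h' := w'.isWalk
  rw [h] at h'
  obtain ⟨v, h1, h2, h3⟩ := isWalk_append.1 h'
  exact ⟨h2.trans (h1.unique w.isWalk), h3.symm⟩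

open Classical in
/-- The edge of `G` under the edge `(w, w')` of the universal cover: the last edge of `w'` if `w'`
extends `w`, and the inverse of the last edge of `w` otherwise. -/
noncomputable def coverEdge {r : G.V} (w w' : G.NBWalk r) (h : w.Extends w' ∨ w'.Extends w) :
    G.E :=
  if hw : w.Extends w' then hw.choose else G.inv (h.resolve_left hw).choose

theorem coverEdge_of_append {r : G.V} {w w' : G.NBWalk r} {e : G.E} (he : w'.1 = w.1 ++ [e])
    (h : w.Extends w' ∨ w'.Extends w) : coverEdge w w' h = e := by
  have hex : w.Extends w' := ⟨e, he⟩
  have := he.symm.trans hex.choose_spec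
  rw [coverEdge, dif_pos hex]
  simpa using this.symm

theorem coverEdge_of_append' {r : G.V} {w w' : G.NBWalk r} {e : G.E} (he : w.1 = w'.1 ++ [e])
    (h : w.Extends w' ∨ w'.Extends w) : coverEdge w w' h = G.inv e := by
  have hex : ¬ w.Extends w' := by
    rintro ⟨f, hf⟩
    simpa [he] using congrArg List.length hf
  have := he.symm.trans (h.resolve_left hex).choose_spec
  rw [coverEdge, dif_neg hex]
  congr 1
  simpa using this.symm

theorem head_coverEdge {r : G.V} {w w' : G.NBWalk r} (h : w.Extends w' ∨ w'.Extends w) :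
    G.head (coverEdge w w' h) = w'.last := by
  obtain ⟨e, he⟩ | ⟨e, he⟩ := h
  · rw [coverEdge_of_append he, (NBWalk.last_of_append he).2]
  · rw [coverEdge_of_append' he, G.head_inv, (NBWalk.last_of_append he).1]

theorem inv_coverEdge {r : G.V} {w w' : G.NBWalk r} (h : w.Extends w' ∨ w'.Extends w) :
    G.inv (coverEdge w w' h) = coverEdge w' w h.symm := by
  obtain ⟨e, he⟩ | ⟨e, he⟩ := h
  · rw [coverEdge_of_append he, coverEdge_of_append' he]
  · rw [coverEdge_of_append' he, coverEdge_of_append he, G.inv_inv]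

theorem tail_coverEdge {r : G.V} {w w' : G.NBWalk r} (h : w.Extends w' ∨ w'.Extends w) :
    G.tail (coverEdge w w' h) = w.last := by
  rw [← G.head_inv, inv_coverEdge, head_coverEdge]

/-- The projection of the universal cover to `G`, which maps a walk to its last vertex. -/
noncomputable def universalCoverHom (G : LoopGraph.{u}) (r : G.V) :
    Hom (G.universalCover r) G where
  onV := NBWalk.last
  onE p := coverEdge p.1.1 p.1.2 p.2
  head_onE p := head_coverEdge p.2
  tail_onE p := tail_coverEdge p.2
  inv_onE p := inv_coverEdge p.2

theorem universalCoverHom_isLocalIso (r : G.V) : (G.universalCoverHom r).IsLocalIso := by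
  intro w
  refine ⟨?_, ?_, ?_⟩
  · rintro p rfl
    exact (G.universalCoverHom r).tail_onE p
  · rintro ⟨⟨w₀, w₁⟩, h₁⟩ (rfl : w₀ = w) ⟨⟨w₀', w₂⟩, h₂⟩ (h₀ : w₀' = w₀) heq
    subst h₀
    replace heq : coverEdge w₀' w₁ h₁ = coverEdge w₀' w₂ h₂ := heq
    suffices w₁ = w₂ by subst this; rfl
    refine Subtype.ext ?_
    -- A walk cannot be continued along the inverse of its last edge, so an edge towards an
    -- extension and an edge towards a truncation never have the same image.
    have key : ∀ {u v : G.NBWalk r} {e f : G.E}, u.1 = w₀'.1 ++ [e] → w₀'.1 = v.1 ++ [f] →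
        e ≠ G.inv f := by
      intro u v e f hu hv hef
      have := u.2.2
      rw [hu, hv, List.append_assoc] at this
      exact this.right_of_append.rel hef
    replace h₁ : w₀'.Extends w₁ ∨ w₁.Extends w₀' := h₁
    replace h₂ : w₀'.Extends w₂ ∨ w₂.Extends w₀' := h₂
    obtain ⟨e, he⟩ | ⟨e, he⟩ := h₁ <;> obtain ⟨f, hf⟩ | ⟨f, hf⟩ := h₂
    · rw [coverEdge_of_append he, coverEdge_of_append hf] at heq
      rw [he, hf, heq]
    · rw [coverEdge_of_append he, coverEdge_of_append' hf] at heq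
      exact (key he hf heq).elim
    · rw [coverEdge_of_append' he, coverEdge_of_append hf] at heq
      exact (key hf he heq.symm).elim
    · exact (List.append_inj' (he.symm.trans hf) rfl).1
  · intro f (hf : G.tail f = w.last)
    by_cases hb : ∃ l e, w.1 = l ++ [e] ∧ f = G.inv e
    · obtain ⟨l, e, hw, rfl⟩ := hb
      have h1 := w.isWalk
      have h2 := w.2.2
      rw [hw] at h1 h2
      obtain ⟨v, h3, -⟩ := isWalk_append.1 h1
      exact ⟨⟨(w, ⟨l, ⟨v, h3⟩, h2.left_of_append⟩), .inr ⟨e, hw⟩⟩, rfl,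
        coverEdge_of_append' hw (.inr ⟨e, hw⟩)⟩
    -- If `f` does not undo the last step of `w`, then it extends `w`.
    · have hnb : G.NonBacktracking (w.1 ++ [f]) := by
        refine List.isChain_append.2 ⟨w.2.2, .singleton _, ?_⟩
        intro e he f' hf' heq
        obtain ⟨l, hl⟩ := List.getLast?_eq_some_iff.1 he
        simp only [List.head?_cons, Option.mem_some_iff] at hf'
        exact hb ⟨l, e, hl, hf'.trans heq⟩
      have hw : G.IsWalk r (w.1 ++ [f]) (G.head f) := isWalk_append.2 ⟨_, w.isWalk, hf, rfl⟩
      exact ⟨⟨(w, ⟨w.1 ++ [f], ⟨_, hw⟩, hnb⟩), .inl ⟨f, rfl⟩⟩, rfl,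
        coverEdge_of_append rfl (.inl ⟨f, rfl⟩)⟩

/-- The image of a non-backtracking walk under a local isomorphism. -/
def NBWalk.map {π : Hom G H} (hπ : π.IsLocalIso) {r : G.V} (w : G.NBWalk r) :
    H.NBWalk (π.onV r) :=
  ⟨w.1.map π.onE, by
    obtain ⟨⟨v, hv⟩, hnb⟩ := w.2
    exact ⟨⟨_, hv.map π⟩, hπ.nonBacktracking_map hv hnb⟩⟩

theorem NBWalk.map_bijective {π : Hom G H} (hπ : π.IsLocalIso) (r : G.V) :
    Function.Bijective (NBWalk.map hπ (r := r)) := by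
  refine ⟨fun w w' h => ?_, fun w => ?_⟩
  · exact Subtype.ext (hπ.lift_unique w.isWalk w'.isWalk (congrArg Subtype.val h))
  · obtain ⟨l, v, h1, h2, -⟩ := hπ.exists_lift w.isWalk
    exact ⟨⟨l, ⟨v, h1⟩, π.nonBacktracking_of_map (h2 ▸ w.2.2)⟩, Subtype.ext h2⟩

theorem NBWalk.map_extends_iff {π : Hom G H} (hπ : π.IsLocalIso) {r : G.V} {w w' : G.NBWalk r} :
    (w.map hπ).Extends (w'.map hπ) ↔ w.Extends w' := by
  constructor
  · rintro ⟨f, hf⟩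
    obtain ⟨l, l', h1, h2, h3⟩ := List.map_eq_append_iff.1 hf
    obtain ⟨e, rfl, -⟩ := List.map_eq_singleton_iff.1 h3
    have h4 := w'.isWalk
    rw [h1] at h4
    obtain ⟨v, h5, -⟩ := isWalk_append.1 h4
    exact ⟨e, by rw [h1, hπ.lift_unique h5 w.isWalk h2]⟩
  · rintro ⟨e, he⟩
    exact ⟨π.onE e, by simp [NBWalk.map, he]⟩

theorem Hom.IsLocalIso.sameUniversalCover {π : Hom G H} (hπ : π.IsLocalIso) (r : G.V) :
    G.SameUniversalCover H := by
  have hbij := NBWalk.map_bijective hπ r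
  refine ⟨r, π.onV r, ⟨NBWalk.map hπ, fun p => ⟨(p.1.1.map hπ, p.1.2.map hπ),
    p.2.imp (NBWalk.map_extends_iff hπ).2 (NBWalk.map_extends_iff hπ).2⟩,
    fun _ => rfl, fun _ => rfl, fun _ => rfl⟩, hbij, ?_, ?_⟩
  · rintro ⟨⟨w₁, w₂⟩, h⟩ ⟨⟨w₁', w₂'⟩, h'⟩ heq
    have heq := congrArg Subtype.val heq
    simp only [Prod.mk.injEq] at heq
    exact Subtype.ext (Prod.ext (hbij.1 heq.1) (hbij.1 heq.2))
  · rintro ⟨⟨w₁, w₂⟩, h⟩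
    obtain ⟨w₁, rfl⟩ := hbij.2 w₁
    obtain ⟨w₂, rfl⟩ := hbij.2 w₂
    exact ⟨⟨(w₁, w₂), h.imp (NBWalk.map_extends_iff hπ).1 (NBWalk.map_extends_iff hπ).1⟩, rfl⟩

theorem lifts_subset_sharingUniversalCover : H.lifts ⊆ H.sharingUniversalCover := by
  rintro G ⟨hfin, hconn, π, -, -, hπ⟩
  exact ⟨hfin, hconn, Hom.IsLocalIso.sameUniversalCover hπ hconn.1.some⟩

theorem SameUniversalCover.exists_common_cover (h : G.SameUniversalCover H) :
    ∃ (T : LoopGraph.{u}) (p : Hom T G) (q : Hom T H),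
      Nonempty T.V ∧ p.IsLocalIso ∧ q.IsLocalIso := by
  obtain ⟨r, s, φ, hV, hE⟩ := h
  exact ⟨G.universalCover r, G.universalCoverHom r, (H.universalCoverHom s).comp φ,
    ⟨⟨[], ⟨r, rfl⟩, .nil⟩⟩, universalCoverHom_isLocalIso r,
    (universalCoverHom_isLocalIso s).comp (φ.isLocalIso_of_bijective hV hE)⟩

/-! ### Equitable colourings and Leighton's common cover -/

variable {I : Type*}

/-- The edges that emanate from `v` and lead to a vertex of colour `j`. -/
def starTo (G : LoopGraph.{u}) (τ : G.V → I) (v : G.V) (j : I) : Set G.E :=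
  {e | G.tail e = v ∧ τ (G.head e) = j}

/-- The colouring `τ` is equitable with degree matrix `r`: each vertex of colour `i` has exactly
`r i j` edges that lead to vertices of colour `j`. -/
def IsEquitable (G : LoopGraph.{u}) (τ : G.V → I) (r : I → I → ℕ) : Prop :=
  ∀ v j, (G.starTo τ v j).ncard = r (τ v) j

theorem Hom.IsLocalIso.ncard_starTo {π : Hom G H} (hπ : π.IsLocalIso) (τ : H.V → I) (v : G.V)
    (j : I) : (G.starTo (τ ∘ π.onV) v j).ncard = (H.starTo τ (π.onV v) j).ncard := by
  have hinj : Set.InjOn π.onE (G.starTo (τ ∘ π.onV) v j) :=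
    (hπ v).injOn.mono fun e he => he.1
  rw [← hinj.ncard_image]
  congr 1
  ext f
  constructor
  · rintro ⟨e, ⟨rfl, h2⟩, rfl⟩
    exact ⟨π.tail_onE e, by rw [π.head_onE]; exact h2⟩
  · rintro ⟨h1, h2⟩
    obtain ⟨e, he, rfl⟩ := (hπ v).surjOn h1
    rw [π.head_onE] at h2
    exact ⟨e, ⟨he, h2⟩, rfl⟩

/-- Two graphs that are locally covered by the same graph `T` have equitable colourings with the
same degree matrix. The colours are the classes of the equivalence relation on the vertices of
both graphs that identifies the two images of each vertex of `T`. -/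
theorem exists_equitable {T : LoopGraph.{u}} {p : Hom T G} {q : Hom T H} (hp : p.IsLocalIso)
    (hq : q.IsLocalIso) :
    ∃ (I : Type u) (τG : G.V → I) (τH : H.V → I) (r : I → I → ℕ),
      G.IsEquitable τG r ∧ H.IsEquitable τH r ∧ ∀ t, τG (p.onV t) = τH (q.onV t) := by
  let R : G.V ⊕ H.V → G.V ⊕ H.V → Prop :=
    fun x y => ∃ t, x = .inl (p.onV t) ∧ y = .inr (q.onV t)
  let τG : G.V → Quot R := fun v => Quot.mk R (.inl v)
  let τH : H.V → Quot R := fun w => Quot.mk R (.inr w)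
  have hτ : ∀ t, τG (p.onV t) = τH (q.onV t) := fun t => Quot.sound ⟨t, rfl, rfl⟩
  let d : G.V ⊕ H.V → Quot R → ℕ :=
    Sum.elim (fun v j => (G.starTo τG v j).ncard) (fun w j => (H.starTo τH w j).ncard)
  have hd : ∀ x y, R x y → d x = d y := by
    rintro _ _ ⟨t, rfl, rfl⟩
    funext j
    have hcomp : τG ∘ p.onV = τH ∘ q.onV := funext hτ
    calc (G.starTo τG (p.onV t) j).ncard = (T.starTo (τG ∘ p.onV) t j).ncard :=
          (hp.ncard_starTo τG t j).symm
      _ = (H.starTo τH (q.onV t) j).ncard := by rw [hcomp, hq.ncard_starTo]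
  exact ⟨Quot R, τG, τH, Quot.lift d hd, fun _ _ => rfl, fun _ _ => rfl, hτ⟩

/-- In a finite graph with an equitable colouring, the edges from a vertex to the vertices of a
given colour can be numbered consecutively. -/
theorem IsEquitable.exists_index {τ : G.V → I} {r : I → I → ℕ} (h : G.IsEquitable τ r)
    (hfin : G.IsFinite) :
    ∃ idx : G.E → ℕ, ∀ v j, Set.BijOn idx (G.starTo τ v j) (Set.Iio (r (τ v) j)) := by
  have := hfin.2
  have hex : ∀ v j, ∃ f : G.E → ℕ, Set.BijOn f (G.starTo τ v j) (Set.Iio (r (τ v) j)) := by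
    intro v j
    refine (Set.toFinite _).exists_bijOn_of_encard_eq ?_
    rw [← (Set.toFinite _).cast_ncard_eq, h v j, Set.encard_eq_coe_toFinset_card]
    simp
  choose f hf using hex
  refine ⟨fun e => f (G.tail e) (τ (G.head e)) e, fun v j => (hf v j).congr ?_⟩
  rintro e ⟨rfl, rfl⟩
  rfl

/-- The number of edges from colour `i` to colour `j` is the number of vertices of colour `i`
times the degree `r i j`. -/
theorem IsEquitable.ncard_edges {τ : G.V → I} {r : I → I → ℕ} (h : G.IsEquitable τ r)
    (hfin : G.IsFinite) (i j : I) :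
    {e | τ (G.tail e) = i ∧ τ (G.head e) = j}.ncard = {v | τ v = i}.ncard * r i j := by
  classical
  have := hfin.1
  have := hfin.2
  have := Fintype.ofFinite G.V
  have := Fintype.ofFinite G.E
  rw [Set.ncard_eq_toFinset_card', Set.ncard_eq_toFinset_card',
    Finset.card_eq_sum_card_fiberwise (f := G.tail) (t := {v | τ v = i}.toFinset)]
  · refine Finset.sum_const_nat fun v hv => ?_
    obtain rfl : τ v = i := by simpa using hv
    rw [← h v j, Set.ncard_eq_toFinset_card']
    congr 1
    ext e
    rw [Finset.mem_filter, Set.mem_toFinset, Set.mem_toFinset]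
    constructor
    · rintro ⟨⟨-, h2⟩, h3⟩
      exact ⟨h3, h2⟩
    · rintro ⟨rfl, h2⟩
      exact ⟨⟨rfl, h2⟩, rfl⟩
  · intro e he
    simpa using (by simpa using he : τ (G.tail e) = i ∧ τ (G.head e) = j).1

theorem ncard_edges_symm (τ : G.V → I) (i j : I) :
    {e | τ (G.tail e) = i ∧ τ (G.head e) = j}.ncard =
      {e | τ (G.tail e) = j ∧ τ (G.head e) = i}.ncard := by
  have hinj : Function.Injective G.inv :=
    Function.LeftInverse.injective (g := G.inv) G.inv_inv
  rw [← Set.ncard_image_of_injective _ hinj]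
  congr 1
  ext e
  constructor
  · rintro ⟨f, ⟨h1, h2⟩, rfl⟩
    exact ⟨by rwa [G.tail_inv], by rwa [G.head_inv]⟩
  · rintro ⟨h1, h2⟩
    exact ⟨G.inv e, ⟨by rwa [G.tail_inv], by rwa [G.head_inv]⟩, G.inv_inv e⟩

/-- The multiplicities in Leighton's construction: `a i` copies of each pair of vertices of
colour `i` and `b i j` copies of each pair of edges from colour `i` to colour `j`. The
bound for `a` depends on `H` alone, not on the colouring. -/
theorem IsEquitable.exists_multiplicities {τ : H.V → I} {r : I → I → ℕ}
    (h : H.IsEquitable τ r) (hfin : H.IsFinite) :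
    ∃ (a : I → ℕ) (b : I → I → ℕ),
      (∀ i, a i ≤ (Nat.card H.V).factorial * (Nat.card H.E).factorial) ∧
      (∀ w, 0 < a (τ w)) ∧ (∀ i j, b i j = b j i) ∧
      ∀ f, b (τ (H.tail f)) (τ (H.head f)) * r (τ (H.tail f)) (τ (H.head f)) =
        a (τ (H.tail f)) := by
  have := hfin.1
  have := hfin.2
  let s := (Nat.card H.V).factorial * (Nat.card H.E).factorial
  have hs : 0 < s := Nat.mul_pos (Nat.factorial_pos _) (Nat.factorial_pos _)
  let m : I → I → ℕ := fun i j => {e | τ (H.tail e) = i ∧ τ (H.head e) = j}.ncard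
  refine ⟨fun i => s / {v | τ v = i}.ncard, fun i j => s / m i j, fun i => Nat.div_le_self _ _,
    fun w => Nat.div_pos ?_ ?_, fun i j => ?_, fun f => ?_⟩
  · exact ((Set.ncard_le_card _).trans (Nat.self_le_factorial _)).trans
      (Nat.le_mul_of_pos_right _ (Nat.factorial_pos _))
  · exact (Set.ncard_pos (Set.toFinite _)).2 ⟨w, rfl⟩
  · exact congrArg (s / ·) (ncard_edges_symm τ i j)
  · set i := τ (H.tail f)
    set j := τ (H.head f)
    have hpos : 0 < m i j := (Set.ncard_pos (Set.toFinite _)).2 ⟨f, rfl, rfl⟩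
    have hm : m i j = {v | τ v = i}.ncard * r i j := h.ncard_edges hfin i j
    have hdvd : m i j ∣ s :=
      (Nat.dvd_factorial hpos (Set.ncard_le_card _)).trans (Nat.dvd_mul_left _ _)
    -- With `m i j = h i * r i j`, the claim reads `s / (h i * r i j) * r i j = s / h i`.
    rw [hm] at hdvd
    change s / m i j * r i j = s / _
    rw [hm, ← Nat.div_div_eq_div_mul]
    exact Nat.div_mul_cancel (Nat.dvd_div_of_mul_dvd hdvd)

/-- Division with remainder after a cyclic shift by `i`. -/
theorem exists_shifted_divMod {a b r i k : ℕ} (hab : b * r = a) (hi : i < r) (hk : k < a) :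
    ∃ l x, l < b ∧ x < r ∧ l * r + (i + x) % r = k := by
  have hr : 0 < r := (Nat.zero_le i).trans_lt hi
  refine ⟨k / r, (k + (r - i)) % r, ?_, Nat.mod_lt _ hr, ?_⟩
  · exact (Nat.div_lt_iff_lt_mul hr).2 (hab ▸ hk)
  · rw [Nat.add_mod_mod, show i + (k + (r - i)) = k + r by omega, Nat.add_mod_right]
    exact Nat.div_add_mod' k r

theorem shifted_divMod_unique {r i l l' x x' : ℕ} (hx : x < r) (hx' : x' < r)
    (h : l * r + (i + x) % r = l' * r + (i + x') % r) : l = l' ∧ x = x' := by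
  have hr : 0 < r := (Nat.zero_le x).trans_lt hx
  have hl : l = l' := by
    simpa [Nat.mul_add_div hr, mul_comm _ r, Nat.div_eq_of_lt (Nat.mod_lt _ hr)] using
      congrArg (· / r) h
  subst hl
  refine ⟨rfl, ?_⟩
  have h1 : i + x ≡ i + x' [MOD r] := Nat.add_left_cancel h
  exact Nat.ModEq.eq_of_lt_of_lt (Nat.ModEq.add_left_cancel' i h1) hx hx'

/-- The input of Leighton's construction of a common cover of two graphs: vertex colourings with
the same degree matrix `r`, consecutive numberings of the edges from each vertex to each colour,
and multiplicities `a i` of the pairs of vertices of colour `i` and `b i j` of the pairs of edges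
from colour `i` to colour `j`. -/
structure LeightonData (G H : LoopGraph.{u}) (I : Type*) where
  τG : G.V → I
  τH : H.V → I
  r : I → I → ℕ
  idxG : G.E → ℕ
  idxH : H.E → ℕ
  a : I → ℕ
  b : I → I → ℕ
  bijOn_idxG : ∀ v j, Set.BijOn idxG (G.starTo τG v j) (Set.Iio (r (τG v) j))
  bijOn_idxH : ∀ w j, Set.BijOn idxH (H.starTo τH w j) (Set.Iio (r (τH w) j))
  b_symm : ∀ i j, b i j = b j i
  b_mul_r : ∀ f, b (τH (H.tail f)) (τH (H.head f)) * r (τH (H.tail f)) (τH (H.head f)) =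
    a (τH (H.tail f))

namespace LeightonData

variable (D : LeightonData G H I)

/-- Copies of the pairs of vertices of the same colour. -/
abbrev Vertex : Type u :=
  {x : G.V × H.V × ℕ // D.τG x.1 = D.τH x.2.1 ∧ x.2.2 < D.a (D.τH x.2.1)}

/-- Copies of the pairs of edges whose tails and whose heads have the same colours. -/
abbrev Edge : Type u :=
  {y : G.E × H.E × ℕ // D.τG (G.tail y.1) = D.τH (H.tail y.2.1) ∧
    D.τG (G.head y.1) = D.τH (H.head y.2.1) ∧
    y.2.2 < D.b (D.τH (H.tail y.2.1)) (D.τH (H.head y.2.1))}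

theorem idxH_lt (f : H.E) : D.idxH f < D.r (D.τH (H.tail f)) (D.τH (H.head f)) :=
  (D.bijOn_idxH _ _).mapsTo ⟨rfl, rfl⟩

theorem idxG_lt (e : G.E) : D.idxG e < D.r (D.τG (G.tail e)) (D.τG (G.head e)) :=
  (D.bijOn_idxG _ _).mapsTo ⟨rfl, rfl⟩

/-- The tail of the `l`-th copy of `(e, f)` is the copy number `l * r + (idxG e + idxH f) % r` of
the pair of tails. As `b * r = a`, each copy of that pair and each `e` (or each `f`) arise from
exactly one choice of `l` and `f` (or of `l` and `e`). -/
def tail (y : D.Edge) : D.Vertex :=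
  ⟨(G.tail y.1.1, H.tail y.1.2.1,
    y.1.2.2 * D.r (D.τH (H.tail y.1.2.1)) (D.τH (H.head y.1.2.1)) +
      (D.idxG y.1.1 + D.idxH y.1.2.1) % D.r (D.τH (H.tail y.1.2.1)) (D.τH (H.head y.1.2.1))),
    y.2.1, by
      have hr := (Nat.zero_le _).trans_lt (D.idxH_lt y.1.2.1)
      have h1 := Nat.mod_lt (D.idxG y.1.1 + D.idxH y.1.2.1) hr
      have h2 := Nat.mul_le_mul_right
        (D.r (D.τH (H.tail y.1.2.1)) (D.τH (H.head y.1.2.1))) (Nat.succ_le_of_lt y.2.2.2)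
      rw [D.b_mul_r, Nat.succ_mul] at h2
      exact (Nat.add_lt_add_left h1 _).trans_le h2⟩

theorem tail_eq_tail_iff {y y' : D.Edge} :
    D.tail y = D.tail y' ↔ G.tail y.1.1 = G.tail y'.1.1 ∧ H.tail y.1.2.1 = H.tail y'.1.2.1 ∧
      y.1.2.2 * D.r (D.τH (H.tail y.1.2.1)) (D.τH (H.head y.1.2.1)) +
        (D.idxG y.1.1 + D.idxH y.1.2.1) % D.r (D.τH (H.tail y.1.2.1)) (D.τH (H.head y.1.2.1)) =
      y'.1.2.2 * D.r (D.τH (H.tail y'.1.2.1)) (D.τH (H.head y'.1.2.1)) +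
        (D.idxG y'.1.1 + D.idxH y'.1.2.1) %
          D.r (D.τH (H.tail y'.1.2.1)) (D.τH (H.head y'.1.2.1)) := by
  simp only [tail, Subtype.mk.injEq, Prod.mk.injEq]

/-- Since `b` is symmetric, the inverse of an edge can be taken componentwise, with the same copy
number. -/
def inv (y : D.Edge) : D.Edge :=
  ⟨(G.inv y.1.1, H.inv y.1.2.1, y.1.2.2), by
    simpa [tail_inv, head_inv, D.b_symm (D.τH (H.head y.1.2.1))] using
      ⟨y.2.2.1, y.2.1, y.2.2.2⟩⟩

theorem inv_inv (y : D.Edge) : D.inv (D.inv y) = y := by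
  simp [inv, LoopGraph.inv_inv]

/-- Leighton's common cover. -/
def graph : LoopGraph.{u} where
  V := D.Vertex
  E := D.Edge
  tail := D.tail
  head y := D.tail (D.inv y)
  inv := D.inv
  inv_inv := D.inv_inv
  head_inv y := by rw [D.inv_inv]

/-- The projection of Leighton's common cover to the first graph. -/
def fst : Hom D.graph G where
  onV x := x.1.1
  onE y := y.1.1
  head_onE y := (G.tail_inv y.1.1).symm
  tail_onE _ := rfl
  inv_onE _ := rfl

/-- The projection of Leighton's common cover to the second graph. -/
def snd : Hom D.graph H where
  onV x := x.1.2.1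
  onE y := y.1.2.1
  head_onE y := (H.tail_inv y.1.2.1).symm
  tail_onE _ := rfl
  inv_onE _ := rfl

theorem fst_isLocalIso : D.fst.IsLocalIso := by
  intro x
  refine ⟨?_, ?_, ?_⟩
  · rintro y rfl
    exact D.fst.tail_onE y
  · rintro ⟨⟨e, f, l⟩, h₁, h₂, h₃⟩ rfl ⟨⟨e', f', l'⟩, h₁', h₂', h₃'⟩ hx (rfl : e = e')
    obtain ⟨hG, hH, hk⟩ := D.tail_eq_tail_iff.1 hx
    simp only at h₁ h₂ h₁' h₂' hG hH hk
    have hh : D.τH (H.head f') = D.τH (H.head f) := h₂'.symm.trans h₂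
    have hlt := D.idxH_lt f'
    rw [hH, hh] at hk hlt
    obtain ⟨rfl, hidx⟩ := shifted_divMod_unique hlt (D.idxH_lt f) hk
    obtain rfl := (D.bijOn_idxH (H.tail f) (D.τH (H.head f))).injOn ⟨hH, hh⟩ ⟨rfl, rfl⟩ hidx
    rfl
  · obtain ⟨⟨v, w, k⟩, hvw, hk⟩ := x
    rintro e (rfl : G.tail e = v)
    simp only at hvw hk
    have hlt := D.idxG_lt e
    rw [hvw] at hlt
    obtain ⟨f₀, ⟨hf₀, hf₀'⟩, -⟩ :=
      (D.bijOn_idxH w (D.τG (G.head e))).surjOn hlt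
    have hab := D.b_mul_r f₀
    rw [hf₀, hf₀'] at hab
    obtain ⟨l, i, hl, hi, hk'⟩ := exists_shifted_divMod hab hlt hk
    obtain ⟨f, ⟨rfl, hf⟩, rfl⟩ := (D.bijOn_idxH w (D.τG (G.head e))).surjOn hi
    rw [← hf] at hl hk'
    exact ⟨⟨(e, f, l), hvw, hf.symm, hl⟩, Subtype.ext (Prod.ext rfl (Prod.ext rfl hk')), rfl⟩

theorem snd_isLocalIso : D.snd.IsLocalIso := by
  intro x
  refine ⟨?_, ?_, ?_⟩
  · rintro y rfl
    exact D.snd.tail_onE y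
  · rintro ⟨⟨e, f, l⟩, h₁, h₂, h₃⟩ rfl ⟨⟨e', f', l'⟩, h₁', h₂', h₃'⟩ hx (rfl : f = f')
    obtain ⟨hG, hH, hk⟩ := D.tail_eq_tail_iff.1 hx
    simp only at h₁ h₂ h₁' h₂' hG hH hk
    have hh : D.τG (G.head e') = D.τG (G.head e) := h₂'.trans h₂.symm
    have hlt := D.idxG_lt e
    have hlt' := D.idxG_lt e'
    rw [h₁', h₂'] at hlt'
    rw [h₁, h₂] at hlt
    rw [add_comm (D.idxG e'), add_comm (D.idxG e)] at hk
    obtain ⟨rfl, hidx⟩ := shifted_divMod_unique hlt' hlt hk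
    obtain rfl := (D.bijOn_idxG (G.tail e) (D.τG (G.head e))).injOn ⟨hG, hh⟩ ⟨rfl, rfl⟩ hidx
    rfl
  · obtain ⟨⟨v, w, k⟩, hvw, hk⟩ := x
    rintro f (rfl : H.tail f = w)
    simp only at hvw hk
    obtain ⟨l, i, hl, hi, hk'⟩ := exists_shifted_divMod (D.b_mul_r f) (D.idxH_lt f) hk
    obtain ⟨e, ⟨rfl, he⟩, rfl⟩ := (D.bijOn_idxG v (D.τH (H.head f))).surjOn (by rwa [hvw])
    rw [add_comm (D.idxH f)] at hk'
    exact ⟨⟨(e, f, l), hvw, he, hl⟩, Subtype.ext (Prod.ext rfl (Prod.ext rfl hk')), rfl⟩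

theorem graph_isFinite (hG : G.IsFinite) (hH : H.IsFinite) : D.graph.IsFinite := by
  have := hG.1
  have := hG.2
  have := hH.1
  have := hH.2
  constructor
  · refine Finite.of_injective (β := Σ x : G.V × H.V, Fin (D.a (D.τH x.2)))
      (fun x : D.Vertex => ⟨(x.1.1, x.1.2.1), ⟨x.1.2.2, x.2.2⟩⟩) ?_
    rintro ⟨⟨v, w, k⟩, h⟩ ⟨⟨v', w', k'⟩, h'⟩ heq
    simp only [Sigma.mk.injEq, Prod.mk.injEq] at heq
    obtain ⟨⟨rfl, rfl⟩, heq⟩ := heq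
    obtain rfl : k = k' := by simpa using heq
    rfl
  · refine Finite.of_injective
      (β := Σ x : G.E × H.E, Fin (D.b (D.τH (H.tail x.2)) (D.τH (H.head x.2))))
      (fun x : D.Edge => ⟨(x.1.1, x.1.2.1), ⟨x.1.2.2, x.2.2.2⟩⟩) ?_
    rintro ⟨⟨v, w, k⟩, h⟩ ⟨⟨v', w', k'⟩, h'⟩ heq
    simp only [Sigma.mk.injEq, Prod.mk.injEq] at heq
    obtain ⟨⟨rfl, rfl⟩, heq⟩ := heq
    obtain rfl : k = k' := by simpa using heq
    rfl

theorem card_vertex_le (hG : G.IsFinite) (hH : H.IsFinite) {s : ℕ} (hs : ∀ i, D.a i ≤ s) :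
    Nat.card D.graph.V ≤ Nat.card H.V * s * Nat.card G.V := by
  have := hG.1
  have := hH.1
  have hinj : Function.Injective
      (fun x : D.Vertex => (x.1.2.1, (⟨x.1.2.2, x.2.2.trans_le (hs _)⟩ : Fin s), x.1.1)) := by
    rintro ⟨⟨v, w, k⟩, h⟩ ⟨⟨v', w', k'⟩, h'⟩ heq
    simp only [Prod.mk.injEq, Fin.mk.injEq] at heq
    obtain ⟨rfl, rfl, rfl⟩ := heq
    rfl
  refine (Nat.card_le_card_of_injective _ hinj).trans_eq ?_
  simp [Nat.card_prod, mul_assoc]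

end LeightonData

/-- The factor between the two minima: the size of Leighton's common cover of `G` and `H` is at
most `c(H)` times the size of `G`. -/
noncomputable def leightonConstant (H : LoopGraph.{u}) : ℕ :=
  Nat.card H.V * ((Nat.card H.V).factorial * (Nat.card H.E).factorial)

/-- **Leighton's theorem**, with a bound for the size of the common cover. -/
theorem SameUniversalCover.exists_common_finite_cover (h : G.SameUniversalCover H)
    (hG : G.IsFinite) (hH : H.IsFinite) :
    ∃ (K : LoopGraph.{u}) (p : Hom K G) (q : Hom K H),
      K.IsFinite ∧ Nonempty K.V ∧ p.IsLocalIso ∧ q.IsLocalIso ∧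
        Nat.card K.V ≤ H.leightonConstant * Nat.card G.V := by
  obtain ⟨T, p, q, ⟨t⟩, hp, hq⟩ := h.exists_common_cover
  obtain ⟨I, τG, τH, r, hτG, hτH, hτ⟩ := exists_equitable hp hq
  obtain ⟨idxG, hidxG⟩ := hτG.exists_index hG
  obtain ⟨idxH, hidxH⟩ := hτH.exists_index hH
  obtain ⟨a, b, ha, hpos, hb, hab⟩ := hτH.exists_multiplicities hH
  let D : LeightonData G H I := ⟨τG, τH, r, idxG, idxH, a, b, hidxG, hidxH, hb, hab⟩
  exact ⟨D.graph, D.fst, D.snd, D.graph_isFinite hG hH,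
    ⟨⟨(p.onV t, q.onV t, 0), hτ t, hpos _⟩⟩, D.fst_isLocalIso, D.snd_isLocalIso,
    D.card_vertex_le hG hH ha⟩

theorem minSize_lifts_le_mul_card (hfin : H.IsFinite) (hconn : H.Connected) {g : ℕ}
    (hG : G ∈ H.sharingUniversalCover) (hg : (g : ℕ∞) ≤ G.girth) :
    minSize H.lifts g ≤ H.leightonConstant * ENat.card G.V := by
  obtain ⟨hGfin, -, hGH⟩ := hG
  obtain ⟨K, p, q, hK, ⟨x⟩, hp, hq, hcard⟩ := hGH.exists_common_finite_cover hGfin hfin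
  have := hGfin.1
  refine (minSize_lifts_le hconn hK x hq (hg.trans hp.girth_le)).trans ?_
  rw [ENat.card_eq_coe_natCard]
  exact_mod_cast hcard

end LoopGraph

theorem mainTheorem8 (H : LoopGraph.{u}) (hfin : H.IsFinite) (hconn : H.Connected) :
    ∃ c : ℕ, ∀ g : ℕ,
      LoopGraph.minSize H.lifts g ≠ ⊤ ∧
      LoopGraph.minSize H.lifts g ≤ (c : ℕ∞) * LoopGraph.minSize H.sharingUniversalCover g ∧
      LoopGraph.minSize H.sharingUniversalCover g ≤ LoopGraph.minSize H.lifts g := by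
  refine ⟨H.leightonConstant, fun g =>
    ⟨LoopGraph.minSize_lifts_ne_top hfin hconn g, ?_, ?_⟩⟩
  · have := hfin.1
    have := hconn.1
    have hc : (H.leightonConstant : ℕ∞) ≠ 0 := by
      have : 0 < H.leightonConstant := Nat.mul_pos Nat.card_pos
        (Nat.mul_pos (Nat.factorial_pos _) (Nat.factorial_pos _))
      exact_mod_cast this.ne'
    rw [LoopGraph.minSize, LoopGraph.minSize, ENat.mul_iInf_of_ne hc]
    refine le_iInf fun G => ?_
    rw [ENat.mul_iInf_of_ne hc]
    exact le_iInf fun hG => LoopGraph.minSize_lifts_le_mul_card hfin hconn hG.1 hG.2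
  · exact le_iInf₂ fun G hG =>
      iInf₂_le G ⟨LoopGraph.lifts_subset_sharingUniversalCover hG.1, hG.2⟩
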